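/- A directed graph $G$ has a finite vertex set $V(G)$ and a finite edge set $E(G)$; every edge has an initial and a terminal vertex, and loops and multiple edges are allowed. A directed path from $u$ to $v\neq u$ is a sequence $u=v_0,x_0,v_1,\dots,x_{n-1},v_n=v$ with pairwise distinct vertices $v_i$, where the edge $x_i$ has initial vertex $v_i$ and terminal vertex $v_{i+1}$. For a vertex $w$ with outgoing edges $x_1,\dots,x_m$ and incoming edges $y_1,\dots,y_n$, and for $1\le l\le\max\{m,n\}$, put $\delta_{w,l}=e_l(x_1,\dots,x_m)-e_l(y_1,\dots,y_n)\in\mathbb Z[E(G)]$, where $e_l$ is the $l$-th elementary symmetric polynomial. The Khovanov–Rozansky complex $\mathscr C_*(G)$ is the Koszul complex over $\mathbb Z[E(G)]$ of the family of all $\delta_{w,l}$. Let $\mathscr H_*(G)$ be its homology, with degree $0$ part $\mathscr H_0(G)$, and let $\mathscr H^{\mathbb Q}_*(G)$ be the homology of $\mathbb Q\otimes_{\mathbb Z}\mathscr C_*(G)$. For a commutative ring $R$ and an $R$-module $M$ put $\mathrm{Kdim}_R M=\mathrm{Kdim}(R/\mathrm{ann}_R M)$, the Krull dimension of $R/\mathrm{ann}_R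 M$. For a set $E\subseteq E(G)$ of edges, $\mathbb Z[E]\subseteq\mathbb Z[E(G)]$ and $\mathbb Q[E]\subseteq\mathbb Q[E(G)]$ are the polynomial subrings in the variables from $E$. Let $u\ne v$ be vertices of a directed graph $G$. Let $G_{u\to v}$ be the directed graph obtained from $G$ by deleting all edges with terminal vertex $u$ and all edges with initial vertex $v$ and then identifying $u$ and $v$ to a single vertex $u\#v$. Let $E(u\#v)$ be the set of edges of $G_{u\to v}$ incident at $u\#v$. Let $\alpha_{u\to v}(G)$ be the maximal number of pairwise edge-disjoint directed paths in $G$ from $u$ to $v$, and let $\beta_{u\to v}(G)$ be the minimal number of edges of $G$ incident at $u$ or $v$ whose removal from $G$ destroys all directed paths from $u$ to $v$. 1. The following are equivalent: (1) there is no directed path in $G$ from $u$ to $v$; (2) $\mathbb Z[E(u\#v)]/\mathrm{ann}_{\mathbb Z[E(u\#v)]}(\mathscr H_0(G_{u\to v}))$ is a finitely generated $\mathbb Z$-module; (3) $\mathbb Z[E(u\#v)]/\mathrm{ann}_{\mathbb Z[E(u\#v)]}(\mathscr H_*(G_{u\to v}))$ is a finitely generated $\mathbb Z$-module; (4) $\mathrm{Kdim}_{\mathbb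 Z[E(u\#v)]}\,\mathscr H_0(G_{u\to v})=1$; (5) $\mathrm{Kdim}_{\mathbb Q[E(u\#v)]}\,\mathscr H_0^{\mathbb Q}(G_{u\to v})=0$. 2. $\alpha_{u\to v}(G)\le\mathrm{Kdim}_{\mathbb Q[E(u\#v)]}\,\mathscr H_0^{\mathbb Q}(G_{u\to v})\le\mathrm{Kdim}_{\mathbb Z[E(u\#v)]}\,\mathscr H_0(G_{u\to v})-1\le\beta_{u\to v}(G)$. -/

import Mathlib

open scoped DirectSum

noncomputable section

/-- A directed graph with vertex set `V` and edge set `E`; loops and multiple edges are allowed. -/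
structure DirGraph (V E : Type*) where
  /-- the initial vertex of an edge -/
  init : E → V
  /-- the terminal vertex of an edge -/
  term : E → V

/-- The Krull dimension of an `R`-module `M`, that is, of the ring `R / ann_R M`. -/
def Kdim (R M : Type*) [CommRing R] [AddCommGroup M] [Module R M] : WithBot ℕ∞ :=
  ringKrullDim (R ⧸ Module.annihilator R M)

namespace Koszul

section Homology

variable {R M : Type*} [CommRing R] [AddCommGroup M] [Module R M]

/-- Degree `n` cycles of an endomorphism `d` (to be thought of as a differential lowering degrees
by one) of a module with graded pieces `A n`. -/
abbrev cycles (d : M →ₗ[R] M) (A : ℕ → Submodule R M) (n : ℕ) : Submodule R M :=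
  LinearMap.ker d ⊓ A n

/-- The `n`-th homology: the degree `n` cycles modulo the image under `d` of the degree `n + 1`
part. In degree `0` of a nonnegatively graded complex every element is a cycle. -/
abbrev homology (d : M →ₗ[R] M) (A : ℕ → Submodule R M) (n : ℕ) : Type _ :=
  ↥(cycles d A n) ⧸ ((A (n + 1)).map d).submoduleOf (cycles d A n)

end Homology

section Complex

variable {R : Type*} [CommRing R] {ι : Type*}

/-- The Koszul complex of a family `r` of elements of `R` has as underlying module the exterior
algebra of the free module on the index set. -/
abbrev Carrier (R ι : Type*) [CommRing R] : Type _ := ExteriorAlgebra R (ι →₀ R)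

/-- The differential of the Koszul complex of the family `r`: contraction with the linear form
`e_i ↦ r i`. So `d (e_{i_1} ∧ ⋯ ∧ e_{i_n})` is the alternating sum, starting with a plus sign, of
the elements `r i_j • e_{i_1} ∧ ⋯ ∧ e_{i_n}` with the factor `e_{i_j}` omitted. -/
def d (r : ι → R) : Carrier R ι →ₗ[R] Carrier R ι :=
  CliffordAlgebra.contractLeft (Finsupp.linearCombination R r)

/-- The part of the Koszul complex in homological degree `n`: the `n`-th exterior power. -/
abbrev piece (R ι : Type*) [CommRing R] (n : ℕ) : Submodule R (Carrier R ι) :=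
  ⋀[R]^n (ι →₀ R)

theorem d_d (r : ι → R) (x : Carrier R ι) : d r (d r x) = 0 :=
  CliffordAlgebra.contractLeft_contractLeft _ _

theorem d_mem (r : ι → R) (n : ℕ) {x : Carrier R ι} (hx : x ∈ piece R ι (n + 1)) :
    d r x ∈ piece R ι n := by
  induction n generalizing x with
  | zero =>
    change x ∈ LinearMap.range (ExteriorAlgebra.ι R) ^ (0 + 1) at hx
    rw [zero_add, pow_one] at hx
    obtain ⟨m, rfl⟩ := hx
    have h : d r (ExteriorAlgebra.ι R m) = algebraMap R _ (Finsupp.linearCombination R r m) :=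
      CliffordAlgebra.contractLeft_ι (0 : QuadraticForm R (ι →₀ R)) _ m
    change _ ∈ LinearMap.range (ExteriorAlgebra.ι R) ^ 0
    rw [h, pow_zero]
    exact Submodule.algebraMap_mem _
  | succ k ih =>
    change x ∈ LinearMap.range (ExteriorAlgebra.ι R) ^ (k + 1 + 1) at hx
    rw [pow_succ'] at hx
    refine Submodule.mul_induction_on hx ?_ ?_
    · rintro _ ⟨m, rfl⟩ y hy
      have h := CliffordAlgebra.contractLeft_ι_mul (Q := (0 : QuadraticForm R (ι →₀ R)))
        (d := Finsupp.linearCombination R r) m y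
      have h2 : ExteriorAlgebra.ι R m * d r y ∈ piece R ι (k + 1) := by
        change _ ∈ LinearMap.range (ExteriorAlgebra.ι R) ^ (k + 1)
        rw [pow_succ']
        exact Submodule.mul_mem_mul ⟨m, rfl⟩ (ih hy)
      exact h ▸ Submodule.sub_mem _ (Submodule.smul_mem _ _ hy) h2
    · intro a b ha hb
      rw [map_add]
      exact Submodule.add_mem _ ha hb

theorem boundaries_le_cycles (r : ι → R) (n : ℕ) :
    (piece R ι (n + 1)).map (d r) ≤ cycles (d r) (piece R ι) n := by
  rintro _ ⟨x, hx, rfl⟩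
  exact ⟨d_d r x, d_mem r n hx⟩

end Complex

end Koszul

namespace DirGraph

variable {V E : Type*}

/-- A directed path from `u` to `v`: pairwise distinct vertices `u = v_0, …, v_n = v` and edges
`x_0, …, x_{n-1}`, where `x_i` goes from `v_i` to `v_{i+1}`. -/
structure DirPath (G : DirGraph V E) (u v : V) where
  length : ℕ
  vert : Fin (length + 1) → V
  edge : Fin length → E
  vert_injective : Function.Injective vert
  vert_zero : vert 0 = u
  vert_last : vert (Fin.last length) = v
  init_edge : ∀ i, G.init (edge i) = vert i.castSucc
  term_edge : ∀ i, G.term (edge i) = vert i.succ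

/-- The set of edges of a directed path. -/
def DirPath.edgeSet {G : DirGraph V E} {u v : V} (P : G.DirPath u v) : Set E :=
  Set.range P.edge

/-- The edges incident at a vertex. -/
def incident (G : DirGraph V E) (w : V) : Set E := {e | G.init e = w ∨ G.term e = w}

/-- The graph obtained by removing a set of edges. -/
def deleteEdges (G : DirGraph V E) (S : Set E) : DirGraph V {e : E // e ∉ S} where
  init e := G.init e
  term e := G.term e

/-- The vertex set obtained from `V` by identifying `u` and `v`. -/
abbrev Glued (u v : V) : Type _ := Quot (fun a b : V => a = u ∧ b = v)

/-- The graph obtained by identifying the vertices `u` and `v`. -/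
def identify (G : DirGraph V E) (u v : V) : DirGraph (Glued u v) E where
  init e := Quot.mk _ (G.init e)
  term e := Quot.mk _ (G.term e)

/-- The edges deleted in forming `G_{u → v}`: those into `u` and those out of `v`. -/
def badEdges (G : DirGraph V E) (u v : V) : Set E := {e | G.term e = u ∨ G.init e = v}

/-- The graph `G_{u → v}`: delete all edges into `u` and all edges out of `v`, and then identify
`u` and `v`. -/
def pathGraph (G : DirGraph V E) (u v : V) :
    DirGraph (Glued u v) {e : E // e ∉ G.badEdges u v} :=
  (G.deleteEdges (G.badEdges u v)).identify u v

/-- The vertex `u # v` of `G_{u → v}` that comes from `u` and `v`. -/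
def gluedVertex (u v : V) : Glued u v := Quot.mk _ u

/-- The set of edges of `G_{u → v}` incident at `u # v`. -/
abbrev gluedEdges (G : DirGraph V E) (u v : V) : Set {e : E // e ∉ G.badEdges u v} :=
  (G.pathGraph u v).incident (gluedVertex u v)

/-- The maximal number of pairwise edge-disjoint directed paths from `u` to `v`
(used for `u ≠ v` and finitely many edges, where these numbers are bounded). -/
def alphaPath (G : DirGraph V E) (u v : V) : ℕ :=
  sSup {k | ∃ P : Fin k → G.DirPath u v,
    Pairwise fun i j => Disjoint (P i).edgeSet (P j).edgeSet}

/-- The minimal number of edges incident at `u` or `v` whose removal destroys all directed paths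
from `u` to `v`. -/
def betaPath (G : DirGraph V E) (u v : V) : ℕ :=
  sInf {k | ∃ S : Finset E, (S : Set E) ⊆ G.incident u ∪ G.incident v ∧
    IsEmpty ((G.deleteEdges (S : Set E)).DirPath u v) ∧ S.card = k}

section Incidence

variable [Finite E]

/-- The edges with initial vertex `w`. -/
def outEdges (G : DirGraph V E) (w : V) : Finset E := (Set.toFinite {e | G.init e = w}).toFinset

/-- The edges with terminal vertex `w`. -/
def inEdges (G : DirGraph V E) (w : V) : Finset E := (Set.toFinite {e | G.term e = w}).toFinset

/-- The index set of the incidence relations: pairs of a vertex `w` and a number `i` with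
`0 ≤ i < max (outdeg w) (indeg w)`, which stands for the degree `i + 1`. -/
abbrev RelIndex (G : DirGraph V E) : Type _ :=
  Σ w : V, Fin (max (G.outEdges w).card (G.inEdges w).card)

/-- The incidence relation `e_l(x_1, …, x_m) - e_l(y_1, …, y_n)` at `w`, where the `x_i` are the
edges out of `w`, the `y_j` are the edges into `w`, and `l = i + 1`. -/
def relation (G : DirGraph V E) (p : G.RelIndex) : MvPolynomial E ℤ :=
  ((G.outEdges p.1).val.map MvPolynomial.X).esymm (p.2 + 1) -
    ((G.inEdges p.1).val.map MvPolynomial.X).esymm (p.2 + 1)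

/-- The `n`-th Khovanov-Rozansky homology of `G`, a module over `ℤ[E]`: the homology of the Koszul
complex of all incidence relations. -/
abbrev KRHomology (G : DirGraph V E) (n : ℕ) : Type _ :=
  Koszul.homology (Koszul.d G.relation) (Koszul.piece (MvPolynomial E ℤ) G.RelIndex) n

/-- The total Khovanov-Rozansky homology of `G`. -/
abbrev KRHomologyTotal (G : DirGraph V E) : Type _ := ⨁ n : ℕ, G.KRHomology n

attribute [local instance] MvPolynomial.algebraMvPolynomial

/-- The `n`-th Khovanov-Rozansky homology of `G` over `ℚ`, a module over `ℚ[E]`: the homology of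
the Koszul complex `C` tensored with `ℚ` over `ℤ`, which is written here as
`ℚ[E] ⊗ C` over `ℤ[E]`. -/
abbrev KRHomologyRat (G : DirGraph V E) (n : ℕ) : Type _ :=
  Koszul.homology ((Koszul.d G.relation).baseChange (MvPolynomial E ℚ))
    (fun k => (Koszul.piece (MvPolynomial E ℤ) G.RelIndex k).baseChange (MvPolynomial E ℚ)) n

end Incidence

end DirGraph

end

/-!
The annihilator of `H_0(G)` is the ideal of incidence relations, which kills all of `H_*(G)`. Over a
domain the elementary symmetric functions of a finite family determine the multiset of its nonzero
members, so a point of the variety cut out by the relations is a labelling of the edges all of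
whose nonzero level sets are balanced: as many edges out of each vertex as into it. The nonzero
level sets that meet a set `S` of edges form a packing of disjoint balanced sets; conversely,
labelling such a packing by independent variables gives a point at which the coordinates from `S`
generate a polynomial ring. So, modulo the relations, the ring of polynomials over `k` in the
variables from `S` has dimension `dim k` plus the maximal size of a packing. In `G_{u → v}` a
balanced set that meets `u # v` contains a directed path from `u` to `v`, and every such path
becomes balanced, so for the edges at `u # v` this maximal size is `α`: the two Krull dimensions are
`α` over `ℚ` and `α + 1` over `ℤ`.
-/

namespace Koszul

section Annihilator

variable {R M C : Type*} [CommRing R] [AddCommGroup M] [Module R M] [Ring C] [Algebra R C]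

theorem mem_annihilator_homology_iff {d : M →ₗ[R] M} {A : ℕ → Submodule R M} {n : ℕ} {a : R} :
    a ∈ Module.annihilator R (homology d A n) ↔
      ∀ x ∈ cycles d A n, a • x ∈ (A (n + 1)).map d := by
  simp only [Module.mem_annihilator, (Submodule.Quotient.mk_surjective _).forall, Subtype.forall,
    ← Submodule.Quotient.mk_smul, Submodule.Quotient.mk_eq_zero]
  rfl

theorem annihilator_homology_zero_eq {d : C →ₗ[R] C} {A : ℕ → Submodule R C} {J : Ideal R}
    (hinj : Function.Injective (algebraMap R C)) (hA : A 0 = 1) (hd : d 1 = 0)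
    (hJ : (A 1).map d = Submodule.map (Algebra.linearMap R C) J) :
    Module.annihilator R (homology d A 0) = J := by
  ext a
  rw [mem_annihilator_homology_iff, zero_add, hJ]
  constructor
  · intro h
    obtain ⟨b, hb, hba⟩ := h 1 ⟨hd, hA ▸ Submodule.one_le.mp le_rfl⟩
    rw [← Algebra.algebraMap_eq_smul_one] at hba
    exact hinj hba ▸ hb
  · rintro ha x ⟨-, hx⟩
    obtain ⟨b, rfl⟩ := Submodule.mem_one.mp (hA ▸ hx)
    exact ⟨a * b, J.mul_mem_right b ha, by simp [Algebra.smul_def]⟩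

end Annihilator

section KoszulComplex

variable {R ι : Type*} [CommRing R]

theorem piece_zero : piece R ι 0 = 1 := pow_zero _

theorem piece_one : piece R ι 1 = LinearMap.range (ExteriorAlgebra.ι R) := pow_one _

theorem ι_mul_mem_piece (m : ι →₀ R) {n : ℕ} {x : Carrier R ι} (hx : x ∈ piece R ι n) :
    ExteriorAlgebra.ι R m * x ∈ piece R ι (n + 1) := by
  rw [piece, ExteriorAlgebra.exteriorPower, pow_succ']
  exact Submodule.mul_mem_mul ⟨m, rfl⟩ hx

variable (r : ι → R)

theorem d_one : d r 1 = 0 :=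
  CliffordAlgebra.contractLeft_one (0 : QuadraticForm R (ι →₀ R)) _

theorem d_ι (m : ι →₀ R) :
    d r (ExteriorAlgebra.ι R m) = algebraMap R _ (Finsupp.linearCombination R r m) :=
  CliffordAlgebra.contractLeft_ι (0 : QuadraticForm R (ι →₀ R)) _ m

theorem d_ι_mul (m : ι →₀ R) (x : Carrier R ι) :
    d r (ExteriorAlgebra.ι R m * x) =
      Finsupp.linearCombination R r m • x - ExteriorAlgebra.ι R m * d r x :=
  CliffordAlgebra.contractLeft_ι_mul (Q := (0 : QuadraticForm R (ι →₀ R)))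
    (d := Finsupp.linearCombination R r) m x

theorem map_d_piece_one :
    (piece R ι 1).map (d r) =
      Submodule.map (Algebra.linearMap R (Carrier R ι)) (Ideal.span (Set.range r)) := by
  rw [piece_one, ← LinearMap.range_comp, ← Ideal.submodule_span_eq,
    ← Finsupp.range_linearCombination, ← LinearMap.range_comp]
  exact congrArg _ (LinearMap.ext (d_ι r))

/-- Exterior multiplication by `m` is a null-homotopy of multiplication by `∑ i, m i * r i`. -/
theorem span_le_annihilator_homology (n : ℕ) :
    Ideal.span (Set.range r) ≤ Module.annihilator R (homology (d r) (piece R ι) n) := by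
  rw [← Ideal.submodule_span_eq, ← Finsupp.range_linearCombination]
  rintro _ ⟨m, rfl⟩
  refine mem_annihilator_homology_iff.mpr fun x hx => ⟨_, ι_mul_mem_piece m hx.2, ?_⟩
  rw [d_ι_mul, LinearMap.mem_ker.mp hx.1, mul_zero, sub_zero]

theorem annihilator_homology_zero :
    Module.annihilator R (homology (d r) (piece R ι) 0) = Ideal.span (Set.range r) :=
  annihilator_homology_zero_eq (ExteriorAlgebra.algebraMap_leftInverse _).injective piece_zero
    (d_one r) (map_d_piece_one r)

end KoszulComplex

section BaseChange

open TensorProduct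

variable {R : Type*} [CommRing R] (S : Type*) [CommRing S] [Algebra R S]

theorem map_baseChange {M N : Type*} [AddCommGroup M] [Module R M] [AddCommGroup N] [Module R N]
    (f : M →ₗ[R] N) (p : Submodule R M) :
    (p.baseChange S).map (f.baseChange S) = (p.map f).baseChange S := by
  simp only [Submodule.baseChange_eq_span, Submodule.map_span, Submodule.map_coe, Set.image_image,
    TensorProduct.mk_apply, LinearMap.baseChange_tmul]

section Algebra

variable (C : Type*) [Ring C] [Algebra R C]

theorem one_baseChange : (1 : Submodule R C).baseChange S = 1 := by
  rw [Submodule.one_eq_span, Submodule.baseChange_span, Set.image_singleton,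
    Submodule.one_eq_span]
  rfl

theorem map_linearMap_baseChange (J : Ideal R) :
    (Submodule.map (Algebra.linearMap R C) J).baseChange S =
      Submodule.map (Algebra.linearMap S (S ⊗[R] C)) (J.map (algebraMap R S)) := by
  rw [Ideal.map, ← Ideal.submodule_span_eq, Submodule.map_span, Submodule.baseChange_eq_span,
    Submodule.map_coe, Submodule.map_coe, Set.image_image, Set.image_image]
  refine congrArg _ (Set.image_congr fun a _ => ?_)
  simp only [TensorProduct.mk_apply, Algebra.linearMap_apply,
    Algebra.TensorProduct.algebraMap_apply, Algebra.algebraMap_self, RingHom.id_apply]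
  exact (Algebra.TensorProduct.tmul_one_eq_one_tmul a).symm

variable {C} in
theorem algebraMap_baseChange_injective (ε : C →ₐ[R] R) :
    Function.Injective (algebraMap S (S ⊗[R] C)) :=
  Function.LeftInverse.injective
    (g := Algebra.TensorProduct.lift (AlgHom.id S S) ((Algebra.ofId R S).comp ε)
      fun _ _ => Commute.all _ _) fun s => by
    simp [Algebra.TensorProduct.algebraMap_apply]

end Algebra

theorem annihilator_homology_zero_baseChange {ι : Type*} (r : ι → R) :
    Module.annihilator S
      (homology ((d r).baseChange S) (fun k => (piece R ι k).baseChange S) 0) =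
      (Ideal.span (Set.range r)).map (algebraMap R S) :=
  annihilator_homology_zero_eq
    (algebraMap_baseChange_injective S ExteriorAlgebra.algebraMapInv)
    (by rw [piece_zero, one_baseChange])
    (by rw [Algebra.TensorProduct.one_def, LinearMap.baseChange_tmul, d_one, tmul_zero])
    (by rw [map_baseChange, map_d_piece_one, map_linearMap_baseChange])

end BaseChange

end Koszul

section ElementarySymmetric

open Multiset

variable {D : Type*} [CommRing D]

theorem map_multiset_esymm {F A : Type*} [CommRing A] [FunLike F A D] [RingHomClass F A D] (f : F)
    (s : Multiset A) (k : ℕ) : f (s.esymm k) = (s.map f).esymm k := by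
  simp only [esymm, map_multiset_sum, powersetCard_map, Multiset.map_map, Function.comp_def,
    map_multiset_prod]

theorem esymm_cons_succ (a : D) (s : Multiset D) (k : ℕ) :
    (a ::ₘ s).esymm (k + 1) = s.esymm (k + 1) + a * s.esymm k := by
  simp [esymm, powersetCard_cons, Multiset.map_map, sum_map_mul_left]

theorem esymm_filter_ne_zero [DecidableEq D] (s : Multiset D) (k : ℕ) :
    (s.filter (· ≠ 0)).esymm k = s.esymm k := by
  induction s using Multiset.induction_on generalizing k with
  | empty => rfl
  | cons a s ih =>
    cases k with
    | zero => simp [esymm]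
    | succ k =>
      rcases eq_or_ne a 0 with rfl | ha
      · rw [filter_cons_of_neg (p := (· ≠ 0)) _ (by simp), ih, esymm_cons_succ, zero_mul, add_zero]
      · rw [filter_cons_of_pos (p := (· ≠ 0)) _ ha, esymm_cons_succ, esymm_cons_succ, ih, ih]

theorem esymm_eq_zero_of_card_lt {s : Multiset D} {k : ℕ} (h : s.card < k) : s.esymm k = 0 := by
  simp [esymm, powersetCard_eq_empty k h]

theorem esymm_card (s : Multiset D) : s.esymm s.card = s.prod := by
  simp [esymm]

variable [IsDomain D] {s t : Multiset D}

theorem card_le_card_of_esymm_eq (hs : 0 ∉ s) (h : ∀ k, s.esymm k = t.esymm k) :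
    s.card ≤ t.card := by
  by_contra! hlt
  have hprod : s.prod = 0 := by rw [← esymm_card, h, esymm_eq_zero_of_card_lt hlt]
  exact hs (prod_eq_zero_iff.mp hprod)

theorem eq_of_esymm_eq (hs : 0 ∉ s) (ht : 0 ∉ t) (h : ∀ k, s.esymm k = t.esymm k) : s = t := by
  have hcard : s.card = t.card :=
    (card_le_card_of_esymm_eq hs h).antisymm (card_le_card_of_esymm_eq ht fun k => (h k).symm)
  rw [← Polynomial.roots_multiset_prod_X_sub_C s, ← Polynomial.roots_multiset_prod_X_sub_C t,
    prod_X_sub_X_eq_sum_esymm, prod_X_sub_X_eq_sum_esymm, hcard]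
  simp only [h]

theorem esymm_eq_iff_filter_ne_zero_eq [DecidableEq D] :
    (∀ i < max s.card t.card, s.esymm (i + 1) = t.esymm (i + 1)) ↔
      s.filter (· ≠ 0) = t.filter (· ≠ 0) := by
  constructor
  · intro h
    refine eq_of_esymm_eq (by simp) (by simp) fun k => ?_
    rw [esymm_filter_ne_zero, esymm_filter_ne_zero]
    rcases k with _ | k
    · simp [esymm]
    · by_cases hk : k < max s.card t.card
      · exact h k hk
      · rw [esymm_eq_zero_of_card_lt (by omega), esymm_eq_zero_of_card_lt (by omega)]
  · intro h i _
    rw [← esymm_filter_ne_zero s, h, esymm_filter_ne_zero]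

end ElementarySymmetric

section Fiber

variable {E D W : Type*} [Finite E]

/-- The fibre of a function on a finite type, as a finset; `G.outEdges w` and `G.inEdges w` are by
definition the fibres of `G.init` and `G.term`. -/
noncomputable def fiberFinset (f : E → D) (τ : D) : Finset E :=
  (Set.toFinite {e | f e = τ}).toFinset

@[simp]
theorem mem_fiberFinset {f : E → D} {τ : D} {e : E} : e ∈ fiberFinset f τ ↔ f e = τ := by
  simp [fiberFinset]

theorem disjoint_fiberFinset (f : E → D) {τ τ' : D} (h : τ ≠ τ') :
    Disjoint (fiberFinset f τ) (fiberFinset f τ') :=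
  Finset.disjoint_left.mpr fun _ he he' =>
    h ((mem_fiberFinset.mp he).symm.trans (mem_fiberFinset.mp he'))

theorem count_map_fiberFinset [DecidableEq D] [DecidableEq W] (f : E → D) (g : E → W) (τ : D)
    (w : W) :
    ((fiberFinset g w).val.map f).count τ = ((fiberFinset f τ).val.map g).count w := by
  rw [Multiset.count_map, Multiset.count_map, ← Finset.filter_val, ← Finset.filter_val]
  congr 2
  ext e
  simp only [Finset.mem_filter, mem_fiberFinset, and_comm, eq_comm]

end Fiber

theorem exists_fiberFinset_eq {E D σ : Type*} [Finite E] [Zero D] {x : σ → D}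
    (hx : Function.Injective x) (hx0 : ∀ s, x s ≠ 0) {C : σ → Finset E}
    (hC : Pairwise fun s t => Disjoint (C s) (C t)) :
    ∃ f : E → D, (∀ s, fiberFinset f (x s) = C s) ∧
      ∀ τ ≠ 0, τ ∉ Set.range x → fiberFinset f τ = ∅ := by
  classical
  let f : E → D := fun e => if h : ∃ s, e ∈ C s then x h.choose else 0
  have hf_of_mem : ∀ {e s}, e ∈ C s → f e = x s := by
    intro e s he
    have h : ∃ s, e ∈ C s := ⟨s, he⟩
    have hs : h.choose = s := hC.eq (Finset.not_disjoint_iff.mpr ⟨e, h.choose_spec, he⟩)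
    simp only [f, dif_pos h, hs]
  have hf_of_notMem : ∀ {e}, (¬∃ s, e ∈ C s) → f e = 0 := fun h => dif_neg h
  refine ⟨f, fun s => Finset.ext fun e => ?_, fun τ hτ hτx => ?_⟩
  · rw [mem_fiberFinset]
    refine ⟨fun he => ?_, hf_of_mem⟩
    by_cases h : ∃ t, e ∈ C t
    · obtain ⟨t, ht⟩ := h
      rwa [← hx ((hf_of_mem ht).symm.trans he)]
    · exact absurd (he.symm.trans (hf_of_notMem h)) (hx0 s)
  · refine Finset.eq_empty_of_forall_notMem fun e he => ?_
    rw [mem_fiberFinset] at he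
    by_cases h : ∃ t, e ∈ C t
    · obtain ⟨t, ht⟩ := h
      exact hτx ⟨t, (hf_of_mem ht).symm.trans he⟩
    · exact hτ (he.symm.trans (hf_of_notMem h))

theorem card_le_card_of_disjoint_of_inter {E σ : Type*} {C : σ → Set E} {T : Finset E}
    (hC : Pairwise fun s t => Disjoint (C s) (C t)) (hT : ∀ s, ∃ e ∈ C s, e ∈ T) :
    Nat.card σ ≤ T.card := by
  choose e heC heT using hT
  have hinj : Function.Injective fun s => (⟨e s, heT s⟩ : T) := fun s t hst =>
    hC.eq (Set.not_disjoint_iff.mpr ⟨e s, heC s, by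
      rw [show e s = e t from congrArg Subtype.val hst]; exact heC t⟩)
  exact (Nat.card_le_card_of_injective _ hinj).trans_eq (Nat.card_eq_finsetCard T)

namespace DirGraph

section Packing

variable {V E : Type*} (G : DirGraph V E)

/-- A set of edges is balanced if at every vertex it has as many outgoing as incoming edges, that
is, if it is an edge-disjoint union of directed cycles. -/
def IsBalanced (C : Finset E) : Prop := C.val.map G.init = C.val.map G.term

/-- A packing of pairwise disjoint balanced sets of edges, each of which meets `S`. -/
structure IsBalancedPacking {σ : Type*} (S : Set E) (C : σ → Finset E) : Prop where
  isBalanced : ∀ s, G.IsBalanced (C s)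
  pairwise_disjoint : Pairwise fun s t => Disjoint (C s) (C t)
  exists_mem : ∀ s, ∃ e ∈ C s, e ∈ S

/-- The maximal number of pairwise disjoint balanced sets of edges that meet `S` (used for finite
`E`, where these numbers are bounded). -/
noncomputable def packingNumber (S : Set E) : ℕ :=
  sSup {n | ∃ C : Fin n → Finset E, G.IsBalancedPacking S C}

variable {G} {S : Set E}

theorem IsBalancedPacking.comp_injective {σ σ' : Type*} {C : σ → Finset E}
    (hC : G.IsBalancedPacking S C) {f : σ' → σ} (hf : Function.Injective f) :
    G.IsBalancedPacking S (C ∘ f) where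
  isBalanced s := hC.isBalanced (f s)
  pairwise_disjoint _ _ h := hC.pairwise_disjoint (hf.ne h)
  exists_mem s := hC.exists_mem (f s)

variable [Finite E]

theorem bddAbove_card_isBalancedPacking (G : DirGraph V E) (S : Set E) :
    BddAbove {n | ∃ C : Fin n → Finset E, G.IsBalancedPacking S C} := by
  have := Fintype.ofFinite E
  refine ⟨Fintype.card E, ?_⟩
  rintro n ⟨C, hC⟩
  simpa using card_le_card_of_disjoint_of_inter (C := fun s => (C s : Set E)) (T := Finset.univ)
    (fun s t h => Finset.disjoint_coe.mpr (hC.pairwise_disjoint h))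
    fun s => (hC.exists_mem s).imp fun e he => ⟨he.1, Finset.mem_univ e⟩

theorem IsBalancedPacking.card_le_packingNumber {σ : Type*} [Finite σ] {C : σ → Finset E}
    (hC : G.IsBalancedPacking S C) : Nat.card σ ≤ G.packingNumber S :=
  le_csSup (bddAbove_card_isBalancedPacking G S)
    ⟨_, hC.comp_injective (Finite.equivFin σ).symm.injective⟩

theorem exists_isBalancedPacking (G : DirGraph V E) (S : Set E) :
    ∃ C : Fin (G.packingNumber S) → Finset E, G.IsBalancedPacking S C := by
  have hzero : G.IsBalancedPacking S (Fin.elim0 : Fin 0 → Finset E) :=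
    ⟨fun s => s.elim0, fun s => s.elim0, fun s => s.elim0⟩
  refine Nat.sSup_mem ?_ (bddAbove_card_isBalancedPacking G S)
  exact ⟨0, _, hzero⟩

end Packing

section RelationIdeal

open MvPolynomial

variable {V E : Type*} [Finite E] (k : Type*) [CommRing k] (G : DirGraph V E)

theorem forall_map_relation_eq_zero_iff {D : Type*} [CommRing D] [IsDomain D]
    (φ : MvPolynomial E ℤ →+* D) :
    (∀ p, φ (G.relation p) = 0) ↔
      ∀ τ ≠ 0, G.IsBalanced (fiberFinset (fun e => φ (X e)) τ) := by
  classical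
  have hcount : ∀ (s t : Multiset D), s.filter (· ≠ 0) = t.filter (· ≠ 0) ↔
      ∀ τ ≠ 0, s.count τ = t.count τ := by
    intro s t
    simp only [Multiset.ext, Multiset.count_filter]
    exact forall_congr' fun τ => by by_cases h : τ = 0 <;> simp [h]
  simp only [relation, map_sub, map_multiset_esymm, sub_eq_zero, Multiset.map_map,
    Function.comp_def, Sigma.forall, Fin.forall_iff]
  calc _ ↔ ∀ w, ∀ τ ≠ 0, ((G.outEdges w).val.map fun e => φ (X e)).count τ =
          ((G.inEdges w).val.map fun e => φ (X e)).count τ := by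
        simp only [← hcount, ← esymm_eq_iff_filter_ne_zero_eq, Multiset.card_map, Finset.card_val]
    _ ↔ ∀ τ ≠ 0, ∀ w, ((G.outEdges w).val.map fun e => φ (X e)).count τ =
          ((G.inEdges w).val.map fun e => φ (X e)).count τ :=
        ⟨fun h τ hτ w => h w τ hτ, fun h w τ hτ => h τ hτ w⟩
    _ ↔ ∀ τ ≠ 0, G.IsBalanced (fiberFinset (fun e => φ (X e)) τ) := by
        simp only [IsBalanced, Multiset.ext]
        refine forall₂_congr fun τ _ => forall_congr' fun w => ?_
        exact Eq.congr (count_map_fiberFinset _ G.init τ w) (count_map_fiberFinset _ G.term τ w)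

/-- The ideal of `k[E]` generated by the incidence relations. -/
noncomputable def relationIdeal : Ideal (MvPolynomial E k) :=
  (Ideal.span (Set.range G.relation)).map (map (Int.castRingHom k))

variable {k}

theorem relationIdeal_le_ker_iff {D : Type*} [CommRing D] [IsDomain D]
    (φ : MvPolynomial E k →+* D) :
    G.relationIdeal k ≤ RingHom.ker φ ↔
      ∀ τ ≠ 0, G.IsBalanced (fiberFinset (fun e => φ (X e)) τ) := by
  rw [relationIdeal, Ideal.map_le_iff_le_comap, Ideal.span_le, Set.range_subset_iff]
  have h := G.forall_map_relation_eq_zero_iff (φ.comp (map (Int.castRingHom k)))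
  simp only [RingHom.comp_apply, map_X] at h
  exact h

end RelationIdeal

end DirGraph

section KrullDimension

theorem ringKrullDim_quotient_le_of_minimalPrimes {A : Type*} [CommRing A] {J : Ideal A}
    {N : WithBot ℕ∞} (h : ∀ q ∈ J.minimalPrimes, ringKrullDim (A ⧸ q) ≤ N) :
    ringKrullDim (A ⧸ J) ≤ N := by
  rw [ringKrullDim_quotient]
  refine iSup_le fun p => ?_
  obtain ⟨q, hq, hqp⟩ := Ideal.exists_minimalPrimes_le (I := J) (J := p.head.1.asIdeal) p.head.2
  refine le_trans ?_ (h q hq)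
  rw [ringKrullDim_quotient]
  have hmem : ∀ i, (p i).1 ∈ PrimeSpectrum.zeroLocus (q : Set A) := fun i =>
    show q ≤ (p i).1.asIdeal from hqp.trans (p.head_le i)
  exact le_iSup (fun s : LTSeries (PrimeSpectrum.zeroLocus (q : Set A)) =>
    (s.length : WithBot ℕ∞)) ⟨p.length, fun i => ⟨(p i).1, hmem i⟩, fun i => p.step i⟩

theorem ringKrullDim_le_of_isIntegral (A B : Type*) [CommRing A] [CommRing B] [Algebra A B]
    [Algebra.IsIntegral A B] : ringKrullDim B ≤ ringKrullDim A :=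
  Order.krullDim_le_of_strictMono (PrimeSpectrum.comap (algebraMap A B)) fun P Q h =>
    Ideal.IsIntegral.comap_lt_comap (I := P.asIdeal) (J := Q.asIdeal) h

variable {k A : Type*} [CommRing k] [CommRing A] [Algebra k A]

theorem ringKrullDim_adjoin_le [IsNoetherianRing k] (T : Set A) [Finite T] :
    ringKrullDim (Algebra.adjoin k T) ≤ ringKrullDim k + Nat.card T := by
  rw [← MvPolynomial.ringKrullDim_of_isNoetherianRing]
  have hrange : (MvPolynomial.aeval (R := k) ((↑) : T → A)).range = Algebra.adjoin k T :=
    (Algebra.adjoin_eq_range k T).symm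
  rw [← hrange]
  exact ringKrullDim_le_of_surjective _ (AlgHom.rangeRestrict_surjective _)

theorem ringKrullDim_adjoin_le_card_sdiff_zero [IsNoetherianRing k] (T : Set A) [Finite T] :
    ringKrullDim (Algebra.adjoin k T) ≤ ringKrullDim k + Nat.card (T \ {0} : Set A) := by
  have : Finite (T \ {0} : Set A) := (Set.toFinite T).sdiff
  have hle : Algebra.adjoin k (T \ {0}) = Algebra.adjoin k T := by
    rw [← Algebra.adjoin_insert_zero, Set.insert_sdiff_singleton, Algebra.adjoin_insert_zero]
  rw [← hle]
  exact ringKrullDim_adjoin_le _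

/-- The image of a subalgebra in a quotient algebra, as a quotient of the subalgebra. -/
noncomputable def quotientComapEquivMap (B : Subalgebra k A) (I : Ideal A) :
    (B ⧸ I.comap (algebraMap B A)) ≃ₐ[k] B.map (Ideal.Quotient.mkₐ k I) :=
  let f := (Ideal.Quotient.mkₐ k I).comp B.val
  (Ideal.quotientEquivAlgOfEq k (by
    ext a
    rw [RingHom.mem_ker, Subtype.ext_iff]
    exact (Ideal.Quotient.eq_zero_iff_mem (I := I)).symm)).trans <|
  (Ideal.quotientKerAlgEquivOfSurjective f.rangeRestrict_surjective).trans <|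
    Subalgebra.equivOfEq _ _ (Subalgebra.range_comp_val B _)

theorem map_supported {E : Type*} (S : Set E) (f : MvPolynomial E k →ₐ[k] A) :
    (MvPolynomial.supported k S).map f =
      Algebra.adjoin k ((fun e => f (MvPolynomial.X e)) '' S) := by
  rw [MvPolynomial.supported_eq_adjoin_X, AlgHom.map_adjoin, Set.image_image]

end KrullDimension

namespace DirGraph

section RelationQuotient

open MvPolynomial

variable {V E : Type*} [Finite E] (G : DirGraph V E) (S : Set E)

theorem isBalancedPacking_fiberFinset {D : Type*} [Zero D] {f : E → D}
    (hf : ∀ τ ≠ 0, G.IsBalanced (fiberFinset f τ)) :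
    G.IsBalancedPacking S fun τ : (f '' S \ {0} : Set D) => fiberFinset f τ where
  isBalanced τ := hf τ τ.2.2
  pairwise_disjoint _ _ h := disjoint_fiberFinset f (Subtype.coe_injective.ne h)
  exists_mem := by
    rintro ⟨_, ⟨e, he, rfl⟩, -⟩
    exact ⟨e, mem_fiberFinset.mpr rfl, he⟩

theorem card_image_sdiff_zero_le_packingNumber {D : Type*} [Zero D] {f : E → D}
    (hf : ∀ τ ≠ 0, G.IsBalanced (fiberFinset f τ)) :
    Nat.card (f '' S \ {0} : Set D) ≤ G.packingNumber S := by
  have : Finite (f '' S \ {0} : Set D) := ((Set.toFinite S).image f).sdiff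
  exact (G.isBalancedPacking_fiberFinset S hf).card_le_packingNumber

variable (k : Type*) [CommRing k]

/-- The quotient of the polynomial ring in the variables from `S` by the polynomials that lie in
the ideal of incidence relations. -/
abbrev RelationQuotient : Type _ :=
  supported k S ⧸ (G.relationIdeal k).comap (algebraMap (supported k S) (MvPolynomial E k))

variable {k} in
theorem isBalanced_fiberFinset_mk {P : Ideal (MvPolynomial E k)} [P.IsPrime]
    (hP : G.relationIdeal k ≤ P) :
    ∀ τ ≠ 0, G.IsBalanced (fiberFinset (fun e => Ideal.Quotient.mk P (X e)) τ) :=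
  (G.relationIdeal_le_ker_iff _).mp (hP.trans_eq (Ideal.mk_ker).symm)

theorem ringKrullDim_relationQuotient_le [IsNoetherianRing k] :
    ringKrullDim (G.RelationQuotient S k) ≤ ringKrullDim k + G.packingNumber S := by
  refine ringKrullDim_quotient_le_of_minimalPrimes fun q hq => ?_
  obtain ⟨P, hP, hGP, rfl⟩ := Ideal.exists_comap_eq_of_mem_minimalPrimes _ q hq
  have hcard := G.card_image_sdiff_zero_le_packingNumber S (G.isBalanced_fiberFinset_mk hGP)
  have : Finite ((fun e => Ideal.Quotient.mkₐ k P (X e)) '' S) := (Set.toFinite S).image _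
  rw [ringKrullDim_eq_of_ringEquiv (quotientComapEquivMap (supported k S) P).toRingEquiv,
    map_supported]
  refine (ringKrullDim_adjoin_le_card_sdiff_zero _).trans ?_
  gcongr
  exact_mod_cast hcard

theorem le_ringKrullDim_relationQuotient [IsNoetherianRing k] [IsDomain k] :
    ringKrullDim k + G.packingNumber S ≤ ringKrullDim (G.RelationQuotient S k) := by
  obtain ⟨C, hC⟩ := G.exists_isBalancedPacking S
  obtain ⟨f, hf, hf0⟩ := exists_fiberFinset_eq (X_injective (R := k)) (X_ne_zero (R := k))
    hC.pairwise_disjoint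
  have hker : G.relationIdeal k ≤ RingHom.ker (aeval (R := k) f) := by
    refine (G.relationIdeal_le_ker_iff (aeval (R := k) f).toRingHom).mpr fun τ hτ => ?_
    simp only [AlgHom.toRingHom_eq_coe, RingHom.coe_coe, aeval_X]
    by_cases hX : τ ∈ Set.range X
    · obtain ⟨s, rfl⟩ := hX
      exact (hf s).symm ▸ hC.isBalanced s
    · rw [hf0 τ hτ hX]
      rfl
  have hsurj : Function.Surjective ((aeval (R := k) f).comp (supported k S).val) := by
    rw [← AlgHom.range_eq_top, Subalgebra.range_comp_val, map_supported, eq_top_iff,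
      ← adjoin_range_X]
    refine Algebra.adjoin_mono (Set.range_subset_iff.mpr fun s => ?_)
    obtain ⟨e, he, heS⟩ := hC.exists_mem s
    exact ⟨e, heS, (aeval_X f e).trans (mem_fiberFinset.mp ((hf s).symm ▸ he))⟩
  calc ringKrullDim k + G.packingNumber S
      = ringKrullDim (MvPolynomial (Fin (G.packingNumber S)) k) := by
        rw [ringKrullDim_of_isNoetherianRing, Nat.card_fin]
    _ ≤ ringKrullDim (G.RelationQuotient S k) :=
        ringKrullDim_le_of_surjective
          (Ideal.Quotient.lift _ ((aeval f).comp (supported k S).val).toRingHom fun _ ha =>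
            RingHom.mem_ker.mp (hker ha))
          (Ideal.Quotient.lift_surjective_of_surjective _ _ hsurj)

theorem ringKrullDim_relationQuotient [IsNoetherianRing k] [IsDomain k] :
    ringKrullDim (G.RelationQuotient S k) = ringKrullDim k + G.packingNumber S :=
  le_antisymm (G.ringKrullDim_relationQuotient_le S k) (G.le_ringKrullDim_relationQuotient S k)

variable {S} in
theorem eq_zero_of_packingNumber_eq_zero (h : G.packingNumber S = 0) {D : Type*} [Zero D]
    {f : E → D} (hf : ∀ τ ≠ 0, G.IsBalanced (fiberFinset f τ)) {e : E} (he : e ∈ S) :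
    f e = 0 := by
  by_contra h0
  have : Finite (f '' S \ {0} : Set D) := ((Set.toFinite S).image f).sdiff
  have hempty := Finite.card_eq_zero_iff.mp
    (Nat.le_zero.mp (h ▸ G.card_image_sdiff_zero_le_packingNumber S hf))
  exact hempty.false ⟨f e, Set.mem_image_of_mem f he, h0⟩

variable {k S} in
theorem X_mem_radical_relationIdeal (h : G.packingNumber S = 0) {e : E} (he : e ∈ S) :
    X e ∈ (G.relationIdeal k).radical := by
  rw [Ideal.radical_eq_sInf, Ideal.mem_sInf]
  rintro P ⟨hGP, hP⟩
  exact Ideal.Quotient.eq_zero_iff_mem.mp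
    (G.eq_zero_of_packingNumber_eq_zero h (G.isBalanced_fiberFinset_mk hGP) he)

theorem finite_relationQuotient (h : G.packingNumber S = 0) :
    Module.Finite k (G.RelationQuotient S k) := by
  have hint : ∀ a ∈ (fun e => Ideal.Quotient.mkₐ k (G.relationIdeal k) (X e)) '' S,
      IsIntegral k a := by
    rintro _ ⟨e, he, rfl⟩
    obtain ⟨n, hn⟩ := G.X_mem_radical_relationIdeal (k := k) h he
    refine ⟨Polynomial.X ^ n, Polynomial.monic_X_pow n, ?_⟩
    rw [Polynomial.eval₂_X_pow, ← map_pow]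
    exact Ideal.Quotient.eq_zero_iff_mem.mpr hn
  have hfg := fg_adjoin_of_finite ((Set.toFinite S).image _) hint
  rw [← map_supported] at hfg
  have := Module.Finite.iff_fg.mpr hfg
  exact Module.Finite.equiv
    (quotientComapEquivMap (supported k S) (G.relationIdeal k)).symm.toLinearEquiv

variable {k} in
theorem finite_relationQuotient_iff [IsNoetherianRing k] [IsDomain k] (hk : ringKrullDim k ≠ ⊤) :
    Module.Finite k (G.RelationQuotient S k) ↔ G.packingNumber S = 0 := by
  refine ⟨fun _ => ?_, G.finite_relationQuotient S k⟩
  have h := ringKrullDim_le_of_isIntegral k (G.RelationQuotient S k)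
  rw [ringKrullDim_relationQuotient] at h
  obtain ⟨d, hd⟩ := WithBot.ne_bot_iff_exists.mp
    (ne_bot_of_le_ne_bot WithBot.coe_ne_bot (ringKrullDim_nonneg_of_nontrivial (R := k)))
  lift d to ℕ using fun hd' => hk (hd ▸ hd' ▸ rfl)
  rw [← hd] at h
  have hle : d + G.packingNumber S ≤ d := by exact_mod_cast h
  lia

end RelationQuotient

section Homology

open MvPolynomial

variable {V E : Type*} [Finite E] (G : DirGraph V E) (S : Set E)

theorem annihilator_KRHomology_zero :
    Module.annihilator (supported ℤ S) (G.KRHomology 0) =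
      (G.relationIdeal ℤ).comap (algebraMap (supported ℤ S) (MvPolynomial E ℤ)) := by
  have hid : map (σ := E) (Int.castRingHom ℤ) = RingHom.id _ := by
    rw [Subsingleton.elim (Int.castRingHom ℤ) (RingHom.id ℤ)]
    exact RingHom.ext map_id
  rw [← Module.comap_annihilator (R := MvPolynomial E ℤ), Koszul.annihilator_homology_zero,
    relationIdeal, hid, Ideal.map_id]

theorem annihilator_KRHomologyTotal :
    Module.annihilator (supported ℤ S) G.KRHomologyTotal =
      Module.annihilator (supported ℤ S) (G.KRHomology 0) := by
  refine Module.annihilator_dfinsupp.trans (le_antisymm (iInf_le _ 0) (le_iInf fun n => ?_))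
  simp only [← Module.comap_annihilator (R := MvPolynomial E ℤ) (R₀ := supported ℤ S)]
  rw [Koszul.annihilator_homology_zero]
  exact Ideal.comap_mono (Koszul.span_le_annihilator_homology G.relation n)

theorem annihilator_KRHomologyRat_zero :
    Module.annihilator (supported ℚ S) (G.KRHomologyRat 0) =
      (G.relationIdeal ℚ).comap (algebraMap (supported ℚ S) (MvPolynomial E ℚ)) := by
  let _ := MvPolynomial.algebraMvPolynomial (R := ℤ) (S := ℚ) (σ := E)
  rw [← Module.comap_annihilator (R := MvPolynomial E ℚ),
    Koszul.annihilator_homology_zero_baseChange]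
  rfl

theorem Kdim_KRHomology_zero :
    Kdim (supported ℤ S) (G.KRHomology 0) = G.packingNumber S + 1 := by
  rw [Kdim, annihilator_KRHomology_zero, ringKrullDim_relationQuotient,
    IsPrincipalIdealRing.ringKrullDim_eq_one ℤ Int.not_isField, add_comm]

theorem Kdim_KRHomologyRat_zero :
    Kdim (supported ℚ S) (G.KRHomologyRat 0) = G.packingNumber S := by
  rw [Kdim, annihilator_KRHomologyRat_zero, ringKrullDim_relationQuotient,
    ringKrullDim_eq_zero_of_field, zero_add]

theorem finite_quotient_annihilator_KRHomology_zero_iff :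
    Module.Finite ℤ (supported ℤ S ⧸ Module.annihilator (supported ℤ S) (G.KRHomology 0)) ↔
      G.packingNumber S = 0 := by
  rw [annihilator_KRHomology_zero]
  convert G.finite_relationQuotient_iff S (k := ℤ) ?_
  rw [IsPrincipalIdealRing.ringKrullDim_eq_one ℤ Int.not_isField]
  decide

end Homology

end DirGraph

theorem map_castSucc_eq_map_succ {α : Type*} {n : ℕ} {x : Fin (n + 1) → α}
    (h : x 0 = x (Fin.last n)) :
    Finset.univ.val.map (x ∘ Fin.castSucc) = Finset.univ.val.map (x ∘ Fin.succ) := by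
  have hsucc : Finset.univ.val.map x = x 0 ::ₘ Finset.univ.val.map (x ∘ Fin.succ) := by
    rw [Fin.univ_succ, Finset.cons_val, Multiset.map_cons, Finset.map_val, Multiset.map_map]
    rfl
  have hcastSucc : Finset.univ.val.map x =
      x (Fin.last n) ::ₘ Finset.univ.val.map (x ∘ Fin.castSucc) := by
    rw [Fin.univ_castSuccEmb, Finset.cons_val, Multiset.map_cons, Finset.map_val,
      Multiset.map_map]
    rfl
  exact (Multiset.cons_inj_right (x 0)).mp (h ▸ hcastSucc.symm.trans (h ▸ hsucc))

namespace DirGraph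

section Paths

variable {V E : Type*} {G : DirGraph V E} {u v : V}

theorem DirPath.vert_castSucc_ne (P : G.DirPath u v) (i : Fin P.length) :
    P.vert i.castSucc ≠ v := fun h =>
  (Fin.castSucc_lt_last i).ne (P.vert_injective (h.trans P.vert_last.symm))

theorem DirPath.vert_succ_ne (P : G.DirPath u v) (i : Fin P.length) : P.vert i.succ ≠ u :=
  fun h => Fin.succ_ne_zero i (P.vert_injective (h.trans P.vert_zero.symm))

theorem DirPath.edge_injective (P : G.DirPath u v) : Function.Injective P.edge := fun i j h =>
  Fin.castSucc_injective _ (P.vert_injective (by rw [← P.init_edge, h, P.init_edge]))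

theorem DirPath.length_pos (huv : u ≠ v) (P : G.DirPath u v) : 0 < P.length := by
  refine Nat.pos_of_ne_zero fun h => huv ?_
  refine P.vert_zero.symm.trans ((congrArg P.vert ?_).trans P.vert_last)
  ext
  simp [h]

theorem DirPath.notMem_badEdges (P : G.DirPath u v) (i : Fin P.length) :
    P.edge i ∉ G.badEdges u v := by
  rintro (h | h)
  · exact P.vert_succ_ne i ((P.term_edge i).symm.trans h)
  · exact P.vert_castSucc_ne i ((P.init_edge i).symm.trans h)

/-- The part of a directed path up to one of its vertices. -/
def DirPath.take (P : G.DirPath u v) (i : Fin (P.length + 1)) : G.DirPath u (P.vert i) where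
  length := i
  vert j := P.vert (Fin.castLE i.2 j)
  edge j := P.edge (Fin.castLE (Nat.lt_succ_iff.mp i.2) j)
  vert_injective := P.vert_injective.comp (Fin.castLE_injective _)
  vert_zero := P.vert_zero
  vert_last := rfl
  init_edge _ := P.init_edge _
  term_edge _ := P.term_edge _

/-- A directed path extended by an edge to a new vertex. -/
def DirPath.snoc (P : G.DirPath u v) (e : E) (he : G.init e = v)
    (hnew : ∀ i, P.vert i ≠ G.term e) : G.DirPath u (G.term e) where
  length := P.length + 1
  vert := Fin.snoc (α := fun _ => V) P.vert (G.term e)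
  edge := Fin.snoc (α := fun _ => E) P.edge e
  vert_injective := by
    rw [Fin.snoc_injective_iff]
    exact ⟨P.vert_injective, fun ⟨i, hi⟩ => hnew i hi⟩
  vert_zero := by
    have h := Fin.snoc_castSucc (α := fun _ => V) (G.term e) P.vert 0
    rw [Fin.castSucc_zero] at h
    exact h.trans P.vert_zero
  vert_last := Fin.snoc_last (α := fun _ => V) _ _
  init_edge i := by
    induction i using Fin.lastCases with
    | last => simpa using he.trans P.vert_last.symm
    | cast i => simpa using P.init_edge i
  term_edge i := by
    induction i using Fin.lastCases with
    | last => simp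
    | cast i =>
      rw [Fin.succ_castSucc, Fin.snoc_castSucc, Fin.snoc_castSucc]
      exact P.term_edge i

/-- The relation between the two ends of the edges from a set `C`; its reflexive transitive closure
is reachability along `C`. -/
def Step (G : DirGraph V E) (C : Set E) (a b : V) : Prop := ∃ e ∈ C, G.init e = a ∧ G.term e = b

theorem exists_dirPath_of_reflTransGen {C : Set E} (h : Relation.ReflTransGen (G.Step C) u v) :
    ∃ P : G.DirPath u v, P.edgeSet ⊆ C := by
  induction h with
  | refl =>
    exact ⟨{ length := 0
             vert := fun _ => u
             edge := Fin.elim0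
             vert_injective := fun i j _ => Subsingleton.elim (α := Fin 1) i j
             vert_zero := rfl
             vert_last := rfl
             init_edge := fun i => i.elim0
             term_edge := fun i => i.elim0 }, Set.range_subset_iff.mpr fun i => i.elim0⟩
  | tail _ hbc ih =>
    obtain ⟨P, hP⟩ := ih
    obtain ⟨e, heC, he, rfl⟩ := hbc
    rw [DirPath.edgeSet, Set.range_subset_iff] at hP
    by_cases hnew : ∃ i, P.vert i = G.term e
    · obtain ⟨i, hi⟩ := hnew
      exact hi ▸ ⟨P.take i, Set.range_subset_iff.mpr fun j => hP _⟩
    · push Not at hnew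
      refine ⟨P.snoc e he hnew, Set.range_subset_iff.mpr fun i => ?_⟩
      change (Fin.snoc (α := fun _ => E) P.edge e : Fin (P.length + 1) → E) i ∈ C
      induction i using Fin.lastCases with
      | last => rwa [Fin.snoc_last]
      | cast i => rw [Fin.snoc_castSucc]; exact hP i

theorem DirPath.exists_mem_edgeSet {S : Set E} (hS : IsEmpty ((G.deleteEdges S).DirPath u v))
    (P : G.DirPath u v) : ∃ e ∈ P.edgeSet, e ∈ S := by
  by_contra! hP
  exact hS.elim
    { length := P.length
      vert := P.vert
      edge := fun i => ⟨P.edge i, hP _ ⟨i, rfl⟩⟩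
      vert_injective := P.vert_injective
      vert_zero := P.vert_zero
      vert_last := P.vert_last
      init_edge := P.init_edge
      term_edge := P.term_edge }

theorem isEmpty_dirPath_deleteEdges_incident (huv : u ≠ v) :
    IsEmpty ((G.deleteEdges (G.incident u)).DirPath u v) :=
  ⟨fun P => (P.edge ⟨0, P.length_pos huv⟩).2
    (Or.inl ((P.init_edge ⟨0, P.length_pos huv⟩).trans P.vert_zero))⟩

end Paths

section Balanced

variable {V E : Type*} {G : DirGraph V E} {C : Finset E}

theorem IsBalanced.exists_term_eq (hC : G.IsBalanced C) {e : E} (he : e ∈ C) :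
    ∃ e' ∈ C, G.term e' = G.init e := by
  have h : G.init e ∈ C.val.map G.init := Multiset.mem_map_of_mem _ he
  rw [hC] at h
  exact Multiset.mem_map.mp h

theorem IsBalanced.init_mem_of_term_mem (hC : G.IsBalanced C) {W : Set V}
    (hW : ∀ e ∈ C, G.init e ∈ W → G.term e ∈ W) {e : E} (he : e ∈ C) (heW : G.term e ∈ W) :
    G.init e ∈ W := by
  classical
  have hcount := congrArg (Multiset.countP (· ∈ W)) hC
  rw [Multiset.countP_map, Multiset.countP_map, ← Finset.filter_val, ← Finset.filter_val] at hcount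
  have hsub : C.filter (G.init · ∈ W) ⊆ C.filter (G.term · ∈ W) := fun e he => by
    rw [Finset.mem_filter] at he ⊢
    exact ⟨he.1, hW e he.1 he.2⟩
  have heq := Finset.eq_of_subset_of_card_le hsub hcount.ge
  have hmem : e ∈ C.filter (G.init · ∈ W) := heq ▸ Finset.mem_filter.mpr ⟨he, heW⟩
  exact (Finset.mem_filter.mp hmem).2

theorem IsBalanced.reflTransGen_term_init (hC : G.IsBalanced C) {e : E} (he : e ∈ C) :
    Relation.ReflTransGen (G.Step C) (G.term e) (G.init e) :=
  hC.init_mem_of_term_mem (W := {w | Relation.ReflTransGen (G.Step C) (G.term e) w})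
    (fun e' he' h => h.tail ⟨e', he', rfl, rfl⟩) he .refl

end Balanced

section Gluing

variable {V E : Type*} {G : DirGraph V E} {u v : V}

theorem Glued.mk_eq_mk_iff {a b : V} :
    (Quot.mk _ a : Glued u v) = Quot.mk _ b ↔
      a = b ∨ (a = u ∨ a = v) ∧ (b = u ∨ b = v) := by
  classical
  have huv : (Quot.mk _ u : Glued u v) = Quot.mk _ v := Quot.sound ⟨rfl, rfl⟩
  constructor
  · intro h
    have h2 := congrArg (Quot.lift (fun a => if a = v then u else a)
      (by rintro a b ⟨rfl, rfl⟩; simp)) h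
    change (if a = v then u else a) = if b = v then u else b at h2
    grind
  · rintro (rfl | ⟨rfl | rfl, rfl | rfl⟩)
    · rfl
    · rfl
    · exact huv
    · exact huv.symm
    · rfl

theorem mk_eq_gluedVertex_iff {a : V} :
    (Quot.mk _ a : Glued u v) = gluedVertex u v ↔ a = u ∨ a = v := by
  rw [gluedVertex, Glued.mk_eq_mk_iff]
  tauto

theorem mem_gluedEdges_iff (e : {e : E // e ∉ G.badEdges u v}) :
    e ∈ G.gluedEdges u v ↔ G.init e = u ∨ G.term e = v := by
  have h1 : G.term e ≠ u := fun h => e.2 (Or.inl h)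
  have h2 : G.init e ≠ v := fun h => e.2 (Or.inr h)
  change (Quot.mk _ (G.init e) : Glued u v) = _ ∨ (Quot.mk _ (G.term e) : Glued u v) = _ ↔ _
  rw [mk_eq_gluedVertex_iff, mk_eq_gluedVertex_iff]
  tauto

theorem exists_mem_term_eq_of_isBalanced {C : Finset {e : E // e ∉ G.badEdges u v}}
    (hC : (G.pathGraph u v).IsBalanced C) (hCS : ∃ e ∈ C, e ∈ G.gluedEdges u v) :
    ∃ e ∈ C, G.term e = v := by
  obtain ⟨e, he, heS⟩ := hCS
  rcases (mem_gluedEdges_iff e).mp heS with hu | hv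
  · obtain ⟨e', he', hterm⟩ := hC.exists_term_eq he
    have hglued : G.term e' = u ∨ G.term e' = v :=
      mk_eq_gluedVertex_iff.mp (hterm.trans (mk_eq_gluedVertex_iff.mpr (Or.inl hu)))
    exact ⟨e', he', hglued.resolve_left fun h => e'.2 (Or.inl h)⟩
  · exact ⟨e, he, hv⟩

theorem reflTransGen_of_pathGraph {C : Set {e : E // e ∉ G.badEdges u v}} {y : Glued u v}
    (h : Relation.ReflTransGen ((G.pathGraph u v).Step C) (gluedVertex u v) y) {b : V}
    (hb : Quot.mk _ b = y) (hbv : b ≠ v) :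
    Relation.ReflTransGen (G.Step (Subtype.val '' C)) u b := by
  induction h generalizing b with
  | refl =>
    obtain rfl := (mk_eq_gluedVertex_iff.mp hb).resolve_right hbv
    exact .refl
  | tail _ hstep ih =>
    obtain ⟨e, he, hinit, rfl⟩ := hstep
    have hwalk := ih hinit fun h => e.2 (Or.inr h)
    rcases Glued.mk_eq_mk_iff.mp hb with rfl | ⟨hbuv, -⟩
    · exact hwalk.tail ⟨e, ⟨e, he, rfl⟩, rfl, rfl⟩
    · obtain rfl := hbuv.resolve_right hbv
      exact .refl

theorem exists_dirPath_of_isBalanced {C : Finset {e : E // e ∉ G.badEdges u v}}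
    (hC : (G.pathGraph u v).IsBalanced C) (hCS : ∃ e ∈ C, e ∈ G.gluedEdges u v) :
    ∃ P : G.DirPath u v, P.edgeSet ⊆ Subtype.val '' (C : Set {e : E // e ∉ G.badEdges u v}) := by
  obtain ⟨e, he, hev⟩ := exists_mem_term_eq_of_isBalanced hC hCS
  have hclosed := hC.reflTransGen_term_init he
  rw [show (G.pathGraph u v).term e = gluedVertex u v from
    mk_eq_gluedVertex_iff.mpr (Or.inr hev)] at hclosed
  have hwalk := reflTransGen_of_pathGraph hclosed rfl fun h => e.2 (Or.inr h)
  exact exists_dirPath_of_reflTransGen (hwalk.tail ⟨e, ⟨e, he, rfl⟩, rfl, hev⟩)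

/-- The edges of a directed path from `u` to `v`, as edges of `G_{u → v}`. -/
def DirPath.gluedEdgeFinset (P : G.DirPath u v) : Finset {e : E // e ∉ G.badEdges u v} :=
  Finset.univ.map ⟨fun i => ⟨P.edge i, P.notMem_badEdges i⟩, fun _ _ h =>
    P.edge_injective (congrArg Subtype.val h)⟩

theorem DirPath.mem_gluedEdgeFinset (P : G.DirPath u v) {e : {e : E // e ∉ G.badEdges u v}} :
    e ∈ P.gluedEdgeFinset ↔ (e : E) ∈ P.edgeSet := by
  simp only [gluedEdgeFinset, Finset.mem_map, Finset.mem_univ, true_and, Subtype.ext_iff]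
  rfl

theorem DirPath.isBalanced_gluedEdgeFinset (P : G.DirPath u v) :
    (G.pathGraph u v).IsBalanced P.gluedEdgeFinset := by
  let x : Fin (P.length + 1) → Glued u v := fun i => Quot.mk _ (P.vert i)
  have hinit : P.gluedEdgeFinset.val.map (G.pathGraph u v).init =
      Finset.univ.val.map (x ∘ Fin.castSucc) := by
    rw [gluedEdgeFinset, Finset.map_val, Multiset.map_map]
    exact Multiset.map_congr rfl fun i _ => congrArg _ (P.init_edge i)
  have hterm : P.gluedEdgeFinset.val.map (G.pathGraph u v).term =
      Finset.univ.val.map (x ∘ Fin.succ) := by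
    rw [gluedEdgeFinset, Finset.map_val, Multiset.map_map]
    exact Multiset.map_congr rfl fun i _ => congrArg _ (P.term_edge i)
  have hends : x 0 = x (Fin.last _) := Quot.sound ⟨P.vert_zero, P.vert_last⟩
  rw [IsBalanced, hinit, hterm, map_castSucc_eq_map_succ hends]

theorem isBalancedPacking_gluedEdgeFinset (huv : u ≠ v) {σ : Type*} {P : σ → G.DirPath u v}
    (hP : Pairwise fun s t => Disjoint (P s).edgeSet (P t).edgeSet) :
    (G.pathGraph u v).IsBalancedPacking (G.gluedEdges u v) fun s => (P s).gluedEdgeFinset where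
  isBalanced s := (P s).isBalanced_gluedEdgeFinset
  pairwise_disjoint s t h := Finset.disjoint_left.mpr fun _ hs ht =>
    Set.disjoint_left.mp (hP h) ((P s).mem_gluedEdgeFinset.mp hs) ((P t).mem_gluedEdgeFinset.mp ht)
  exists_mem s := by
    let i : Fin (P s).length := ⟨0, (P s).length_pos huv⟩
    exact ⟨⟨(P s).edge i, (P s).notMem_badEdges i⟩, (P s).mem_gluedEdgeFinset.mpr ⟨i, rfl⟩,
      (mem_gluedEdges_iff _).mpr (Or.inl (((P s).init_edge i).trans (P s).vert_zero))⟩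

theorem alphaPath_eq_packingNumber (huv : u ≠ v) :
    G.alphaPath u v = (G.pathGraph u v).packingNumber (G.gluedEdges u v) := by
  refine congrArg sSup (Set.ext fun n => ⟨?_, ?_⟩)
  · rintro ⟨P, hP⟩
    exact ⟨_, isBalancedPacking_gluedEdgeFinset huv hP⟩
  rintro ⟨C, hC⟩
  choose P hP using fun s => exists_dirPath_of_isBalanced (hC.isBalanced s) (hC.exists_mem s)
  refine ⟨P, fun s t h => Disjoint.mono (hP s) (hP t) ?_⟩
  exact (Set.disjoint_image_iff Subtype.val_injective).mpr
    (Finset.disjoint_coe.mpr (hC.pairwise_disjoint h))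

end Gluing

section AlphaBeta

variable {V E : Type*} [Finite E] {G : DirGraph V E} {u v : V}

theorem alphaPath_eq_zero_iff (huv : u ≠ v) : G.alphaPath u v = 0 ↔ IsEmpty (G.DirPath u v) := by
  rw [alphaPath_eq_packingNumber huv]
  refine ⟨fun h => ⟨fun P => ?_⟩, fun h => ?_⟩
  · have hpack := isBalancedPacking_gluedEdgeFinset huv (P := fun _ : Unit => P)
      fun _ _ hne => (hne rfl).elim
    exact absurd (h ▸ hpack.card_le_packingNumber) (by simp)
  · obtain ⟨C, hC⟩ := (G.pathGraph u v).exists_isBalancedPacking (G.gluedEdges u v)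
    by_contra h0
    let s : Fin ((G.pathGraph u v).packingNumber (G.gluedEdges u v)) := ⟨0, Nat.pos_of_ne_zero h0⟩
    obtain ⟨P, -⟩ := exists_dirPath_of_isBalanced (hC.isBalanced s) (hC.exists_mem s)
    exact h.elim P

theorem alphaPath_le_betaPath (huv : u ≠ v) : G.alphaPath u v ≤ G.betaPath u v := by
  have hcut : {k | ∃ S : Finset E, (S : Set E) ⊆ G.incident u ∪ G.incident v ∧
      IsEmpty ((G.deleteEdges (S : Set E)).DirPath u v) ∧ S.card = k}.Nonempty := by
    refine ⟨_, (Set.toFinite (G.incident u)).toFinset, ?_, ?_, rfl⟩ <;>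
      rw [Set.Finite.coe_toFinset]
    exacts [Set.subset_union_left, isEmpty_dirPath_deleteEdges_incident huv]
  obtain ⟨T, -, hT, hcard⟩ := Nat.sInf_mem hcut
  rw [betaPath, ← hcard]
  refine csSup_le' ?_
  rintro n ⟨P, hP⟩
  simpa using card_le_card_of_disjoint_of_inter hP fun s => (P s).exists_mem_edgeSet hT

end AlphaBeta

end DirGraph

theorem mainTheorem12_general {V E : Type*} [Finite E] (G : DirGraph V E) {u v : V}
    (huv : u ≠ v) :
    [ IsEmpty (G.DirPath u v),
      Module.Finite ℤ (MvPolynomial.supported ℤ (G.gluedEdges u v) ⧸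
        Module.annihilator (MvPolynomial.supported ℤ (G.gluedEdges u v))
          ((G.pathGraph u v).KRHomology 0)),
      Module.Finite ℤ (MvPolynomial.supported ℤ (G.gluedEdges u v) ⧸
        Module.annihilator (MvPolynomial.supported ℤ (G.gluedEdges u v))
          (G.pathGraph u v).KRHomologyTotal),
      Kdim (MvPolynomial.supported ℤ (G.gluedEdges u v)) ((G.pathGraph u v).KRHomology 0) = 1,
      Kdim (MvPolynomial.supported ℚ (G.gluedEdges u v)) ((G.pathGraph u v).KRHomologyRat 0) = 0
    ].TFAE ∧
    Kdim (MvPolynomial.supported ℚ (G.gluedEdges u v)) ((G.pathGraph u v).KRHomologyRat 0) =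
      G.alphaPath u v ∧
    Kdim (MvPolynomial.supported ℤ (G.gluedEdges u v)) ((G.pathGraph u v).KRHomology 0) =
      G.alphaPath u v + 1 ∧
    G.alphaPath u v ≤ G.betaPath u v := by
  rw [DirGraph.annihilator_KRHomologyTotal,
    DirGraph.finite_quotient_annihilator_KRHomology_zero_iff, DirGraph.Kdim_KRHomology_zero,
    DirGraph.Kdim_KRHomologyRat_zero, ← DirGraph.alphaPath_eq_packingNumber huv,
    ← DirGraph.alphaPath_eq_zero_iff huv]
  refine ⟨?_, rfl, rfl, DirGraph.alphaPath_le_betaPath huv⟩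
  have hint : (G.alphaPath u v + 1 : WithBot ℕ∞) = 1 ↔ G.alphaPath u v = 0 := by
    norm_cast
    lia
  have hrat : (G.alphaPath u v : WithBot ℕ∞) = 0 ↔ G.alphaPath u v = 0 := by norm_cast
  rw [hint, hrat]
  simp

theorem mainTheorem12 {V E : Type*} [Finite V] [Finite E] (G : DirGraph V E) (u v : V)
    (huv : u ≠ v) :
    [ IsEmpty (G.DirPath u v),
      Module.Finite ℤ (MvPolynomial.supported ℤ (G.gluedEdges u v) ⧸
        Module.annihilator (MvPolynomial.supported ℤ (G.gluedEdges u v))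
          ((G.pathGraph u v).KRHomology 0)),
      Module.Finite ℤ (MvPolynomial.supported ℤ (G.gluedEdges u v) ⧸
        Module.annihilator (MvPolynomial.supported ℤ (G.gluedEdges u v))
          (G.pathGraph u v).KRHomologyTotal),
      Kdim (MvPolynomial.supported ℤ (G.gluedEdges u v)) ((G.pathGraph u v).KRHomology 0) = 1,
      Kdim (MvPolynomial.supported ℚ (G.gluedEdges u v)) ((G.pathGraph u v).KRHomologyRat 0) = 0
    ].TFAE ∧
    (G.alphaPath u v : WithBot ℕ∞) ≤
      Kdim (MvPolynomial.supported ℚ (G.gluedEdges u v)) ((G.pathGraph u v).KRHomologyRat 0) ∧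
    Kdim (MvPolynomial.supported ℚ (G.gluedEdges u v)) ((G.pathGraph u v).KRHomologyRat 0) + 1 ≤
      Kdim (MvPolynomial.supported ℤ (G.gluedEdges u v)) ((G.pathGraph u v).KRHomology 0) ∧
    Kdim (MvPolynomial.supported ℤ (G.gluedEdges u v)) ((G.pathGraph u v).KRHomology 0) ≤
      (G.betaPath u v : WithBot ℕ∞) + 1 := by
  obtain ⟨htfae, hrat, hint, hle⟩ := mainTheorem12_general G huv
  refine ⟨htfae, ?_⟩
  rw [hrat, hint]
  exact ⟨le_rfl, le_rfl, by exact_mod_cast Nat.add_le_add_right hle 1⟩
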